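/- Let $X$ be an irreducible, reduced, normal, Hausdorff, paracompact complex space, and let $\Delta=\sum_i\bigl(1-\tfrac1{m_i}\bigr)[Z_i]$ be a locally finite formal sum over pairwise distinct irreducible reduced hypersurfaces $Z_i\subset X$ with multiplicities $m_i\in\{2,3,\dots\}\cup\{\infty\}$ (weight $1$ if $m_i=\infty$). Write $|\Delta|=\bigcup_i Z_i$, and $|\Delta_1|=\bigcup_{m_i=\infty}Z_i$. Let $D$ be the open unit disc in $\mathbb C$. An orbifold morphism $f:D\to(X/\Delta)$ is a holomorphic map $f:D\to X$ with $f(D)\not\subset|\Delta|$, with $f(D)\cap Z_i=\emptyset$ whenever $m_i=\infty$, and with $\operatorname{mult}_x(f^*Z_i)\ge m_i$ for all $i$ and all $x\in D$ with $f(x)\in Z_i$; here $\operatorname{mult}_x(f^*Z_i)$ is the least vanishing order at $x$ of $g\circ f$, over all germs $g$ at $f(x)$ of holomorphic functions vanishing on $Z_i$ (the vanishing order of $\rho\circ f$ if $Z_i$ has a local defining function $\rho$). The orbifold Kobayashi pseudodistance is the largest pseudodistance on $X\setminus|\Delta_1|$ such that every orbifold morphism $D\to(X/\Delta)$ is distance-decreasing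 with respect to the Poincaré distance on $D$. Assume that there are two distinct points $p,q\in X\setminus|\Delta_1|$ whose orbifold Kobayashi pseudodistance is zero, and let $h$ be a (smooth) Hermitian metric on $X$. Then there exist a sequence of points $p_n\in X\setminus|\Delta_1|$ and orbifold morphisms $f_n:D\to(X/\Delta)$ such that $f_n(0)=p_n$ for all $n$, $\lim_n p_n=p$ and $\lim_n\|f_n'(0)\|=+\infty$, where the norm is calculated with respect to the Poincaré metric on $D$ and the Hermitian metric $h$ on $X$. -/

import Mathlib

open Filter Topology Set Metric
open scoped ENNReal ComplexConjugate ComplexOrder ContDiff Matrix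

noncomputable section

namespace OrbifoldKobayashi

universe u

/-! ### Reduced complex spaces

A reduced complex space is described as a topological space with a subsheaf of the sheaf of
complex valued functions, given through its stalks (subrings of the rings of germs of functions),
which is locally isomorphic to an analytic subset of an open set of `ℂⁿ` with the sheaf of
restrictions of holomorphic functions. -/

/-- `A` is a (closed) analytic subset of the open set `Ω` of `ℂⁿ`. -/
def IsAnalyticInDomain {n : ℕ} (Ω A : Set (Fin n → ℂ)) : Prop :=
  A ⊆ Ω ∧ ∀ a ∈ Ω, ∃ V ∈ 𝓝 a, ∃ S : Set ((Fin n → ℂ) → ℂ), S.Finite ∧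
    (∀ g ∈ S, ∀ z ∈ V, AnalyticAt ℂ g z) ∧ A ∩ V = {z ∈ V | ∀ g ∈ S, g z = 0}

/-- A local embedding of `X` with respect to a family of stalks `O`: a homeomorphism of an open
subset `source` of `X` onto an analytic subset of an open set `target` of `ℂⁿ`, under which the
germs in `O` are exactly the germs of restrictions of holomorphic functions. -/
structure LocalEmbedding {X : Type u} [TopologicalSpace X]
    (O : ∀ x : X, Subring (Germ (𝓝 x) ℂ)) where
  dim : ℕ
  source : Set X
  target : Set (Fin dim → ℂ)
  toFun : X → Fin dim → ℂ
  isOpen_source : IsOpen source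
  isOpen_target : IsOpen target
  isEmbedding : IsEmbedding (source.domRestrict toFun)
  isAnalytic_image : IsAnalyticInDomain target (toFun '' source)
  mem_stalk_iff : ∀ y ∈ source, ∀ g : Germ (𝓝 y) ℂ, g ∈ O y ↔
    ∃ G : (Fin dim → ℂ) → ℂ, AnalyticAt ℂ G (toFun y) ∧ g = ((G ∘ toFun : X → ℂ) : Germ (𝓝 y) ℂ)

/-- The structure of a reduced complex space on a topological space (the Hausdorff property and
paracompactness are separate type classes). `stalk x` is the ring of germs at `x` of holomorphic
functions. -/
class ReducedComplexSpace (X : Type u) [TopologicalSpace X] where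
  stalk : ∀ x : X, Subring (Germ (𝓝 x) ℂ)
  exists_localEmbedding : ∀ x : X, ∃ e : LocalEmbedding stalk, x ∈ e.source

variable {X : Type u} [TopologicalSpace X] [ReducedComplexSpace X]

/-- The local ring of germs of holomorphic functions at `x`. -/
abbrev Stalk (x : X) : Subring (Germ (𝓝 x) ℂ) := ReducedComplexSpace.stalk x

/-- The function `g` (defined near `x`) is holomorphic at `x`. -/
def HolAt (g : X → ℂ) (x : X) : Prop := (g : Germ (𝓝 x) ℂ) ∈ Stalk x

variable (X) in
/-- A complex space is normal if all its local rings are integrally closed domains. -/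
def IsNormalSpace : Prop :=
  ∀ x : X, IsDomain (Stalk x) ∧ IsIntegrallyClosed (Stalk x)

/-- Closed analytic subsets of a complex space. -/
def IsAnalytic (Z : Set X) : Prop :=
  ∀ x : X, ∃ V ∈ 𝓝 x, ∃ S : Set (X → ℂ), S.Finite ∧
    (∀ g ∈ S, ∀ y ∈ V, HolAt g y) ∧ Z ∩ V = {y ∈ V | ∀ g ∈ S, g y = 0}

/-- Irreducible analytic subsets of a complex space. -/
def IsIrreducibleAnalytic (Z : Set X) : Prop :=
  IsAnalytic Z ∧ Z.Nonempty ∧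
    ∀ A B : Set X, IsAnalytic A → IsAnalytic B → Z ⊆ A ∪ B → Z ⊆ A ∨ Z ⊆ B

/-- The ideal of the germs of holomorphic functions at `x` that vanish on `Z`. -/
def idealAt (Z : Set X) (x : X) : Ideal (Stalk x) where
  carrier := {g | ∃ f : X → ℂ, (f : Germ (𝓝 x) ℂ) = g.1 ∧ ∀ᶠ y in 𝓝 x, y ∈ Z → f y = 0}
  zero_mem' := ⟨0, rfl, Eventually.of_forall fun _ _ => rfl⟩
  add_mem' := by
    rintro a b ⟨f, hf, hf0⟩ ⟨g, hg, hg0⟩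
    refine ⟨f + g, ?_, ?_⟩
    · rw [Germ.coe_add, hf, hg]; rfl
    · filter_upwards [hf0, hg0] with y h1 h2 hy
      simp [h1 hy, h2 hy]
  smul_mem' := by
    rintro ⟨c, hc⟩ a ⟨f, hf, hf0⟩
    induction c using Germ.inductionOn with
    | _ k =>
      refine ⟨k * f, ?_, ?_⟩
      · rw [Germ.coe_mul, hf]; rfl
      · filter_upwards [hf0] with y h1 hy
        simp [h1 hy]

/-- An irreducible (reduced) hypersurface: an irreducible analytic subset of codimension one,
the codimension at a point being the height of the ideal of `Z` in the local ring. -/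
def IsHypersurface (Z : Set X) : Prop :=
  IsIrreducibleAnalytic Z ∧ ∀ x ∈ Z, (idealAt Z x).height = 1

/-! ### Orbifold divisors -/

variable (X) in
/-- An orbifold divisor `Δ = ∑ (1 - 1 / m_Z) [Z]`, a locally finite sum over distinct irreducible
hypersurfaces with multiplicities `m_Z ∈ {2, 3, …} ∪ {∞}` (so that the coefficients are positive;
a component of multiplicity `∞` has coefficient, or weight, `1`). -/
structure OrbifoldDivisor where
  components : Set (Set X)
  isHypersurface : ∀ Z ∈ components, IsHypersurface Z
  locallyFinite : LocallyFinite fun Z : components => (Z : Set X)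
  mult : components → ℕ∞
  two_le_mult : ∀ Z, 2 ≤ mult Z

/-- The support `|Δ|`. -/
def OrbifoldDivisor.support (Δ : OrbifoldDivisor X) : Set X :=
  ⋃ Z : Δ.components, (Z : Set X)

/-- The union `|Δ₁|` of the components of weight one, that is, of multiplicity `∞`. -/
def OrbifoldDivisor.supportOne (Δ : OrbifoldDivisor X) : Set X :=
  ⋃ Z : Δ.components, ⋃ _ : Δ.mult Z = ⊤, (Z : Set X)

/-! ### Orbifold discs -/

variable (X) in
/-- A holomorphic map from the open unit disc of `ℂ` to `X`, given by a function on `ℂ` of which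
only the values on the unit disc matter. -/
structure HolDisc where
  toFun : ℂ → X
  continuousOn : ContinuousOn toFun (ball 0 1)
  holomorphic : ∀ z ∈ ball (0 : ℂ) 1, ∀ g : X → ℂ, HolAt g (toFun z) →
    AnalyticAt ℂ (fun w => g (toFun w)) z

instance : CoeFun (HolDisc X) fun _ => ℂ → X := ⟨HolDisc.toFun⟩

/-- The multiplicity at `z` of the pull-back `f^* Z`: the smallest vanishing order at `z` of the
pull-back of a germ of a holomorphic function that vanishes on `Z`. If `Z` has a local defining
function `ρ` at `f z`, this is the vanishing order of `ρ ∘ f`. -/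
def HolDisc.pullbackMult (f : HolDisc X) (Z : Set X) (z : ℂ) : ℕ∞ :=
  ⨅ (g : X → ℂ) (_ : HolAt g (f z) ∧ ∀ᶠ y in 𝓝 (f z), y ∈ Z → g y = 0),
    analyticOrderAt (fun w => g (f w)) z

/-- An orbifold morphism (in the non-classical sense) from the unit disc to `(X/Δ)`. -/
structure OrbifoldDisc (Δ : OrbifoldDivisor X) extends HolDisc X where
  not_subset_support : ∃ z ∈ ball (0 : ℂ) 1, toFun z ∉ Δ.support
  mult_le : ∀ Z : Δ.components, ∀ z ∈ ball (0 : ℂ) 1, toFun z ∈ (Z : Set X) →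
    Δ.mult Z ≤ toHolDisc.pullbackMult Z z
  notMem_of_mult_eq_top : ∀ Z : Δ.components, Δ.mult Z = ⊤ →
    ∀ z ∈ ball (0 : ℂ) 1, toFun z ∉ (Z : Set X)

instance (Δ : OrbifoldDivisor X) : CoeFun (OrbifoldDisc Δ) fun _ => ℂ → X :=
  ⟨fun f => f.toFun⟩

/-! ### The orbifold Kobayashi pseudodistance -/

/-- The Poincaré distance on the unit disc, the distance of the metric `|dz| / (1 - |z|²)`. -/
def poincareDist (z w : ℂ) : ℝ := Real.artanh (‖z - w‖ / ‖1 - conj w * z‖)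

/-- Pseudodistances on a set. -/
structure IsPseudodistance {S : Type u} (ρ : S → S → ℝ) : Prop where
  nonneg : ∀ x y, 0 ≤ ρ x y
  self : ∀ x, ρ x x = 0
  symm : ∀ x y, ρ x y = ρ y x
  triangle : ∀ x y z, ρ x z ≤ ρ x y + ρ y z

/-- The pseudodistances on `X \ |Δ₁|` for which every orbifold morphism from the unit disc is
distance-decreasing. -/
def admissiblePseudodistances (Δ : OrbifoldDivisor X) :
    Set (↥(Δ.supportOneᶜ) → ↥(Δ.supportOneᶜ) → ℝ) :=
  {ρ | IsPseudodistance ρ ∧ ∀ f : OrbifoldDisc Δ, ∀ z ∈ ball (0 : ℂ) 1, ∀ w ∈ ball (0 : ℂ) 1,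
    ∀ x y : ↥(Δ.supportOneᶜ), f z = x → f w = y → ρ x y ≤ poincareDist z w}

/-- The orbifold Kobayashi pseudodistance on `X \ |Δ₁|`, the largest pseudodistance for which every
orbifold morphism from the unit disc is distance-decreasing, as the pointwise supremum of all of
them. -/
def kobayashiDist (Δ : OrbifoldDivisor X) (x y : ↥(Δ.supportOneᶜ)) : ℝ≥0∞ :=
  ⨆ ρ ∈ admissiblePseudodistances Δ, ENNReal.ofReal (ρ x y)

/-! ### Tangent vectors and hermitian metrics -/

/-- The Zariski tangent space at `x`: the `ℂ`-linear derivations of the local ring at `x` with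
values in `ℂ` (additive, subject to the Leibniz rule, zero on constants). -/
def TangentSpaceAt (x : X) : Submodule ℂ (Stalk x → ℂ) where
  carrier := {v | (∀ a b, v (a + b) = v a + v b) ∧
    (∀ a b, v (a * b) = a.1.value * v b + b.1.value * v a) ∧
    ∀ a : Stalk x, ∀ c : ℂ, a.1 = ((fun _ => c : X → ℂ) : Germ (𝓝 x) ℂ) → v a = 0}
  zero_mem' := by simp
  add_mem' := by
    rintro v w ⟨h1, h2, h3⟩ ⟨k1, k2, k3⟩
    refine ⟨fun a b => ?_, fun a b => ?_, fun a c hc => ?_⟩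
    · simp only [Pi.add_apply, h1, k1]; ring
    · simp only [Pi.add_apply, h2, k2]; ring
    · simp only [Pi.add_apply, h3 a c hc, k3 a c hc, add_zero]
  smul_mem' := by
    rintro t v ⟨h1, h2, h3⟩
    refine ⟨fun a b => ?_, fun a b => ?_, fun a c hc => ?_⟩
    · simp only [Pi.smul_apply, smul_eq_mul, h1]; ring
    · simp only [Pi.smul_apply, smul_eq_mul, h2]; ring
    · simp only [Pi.smul_apply, smul_eq_mul, h3 a c hc, mul_zero]

/-- The local embeddings of a complex space. -/
abbrev Chart (X : Type u) [TopologicalSpace X] [ReducedComplexSpace X] :=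
  LocalEmbedding (fun x : X => Stalk x)

/-- The germ of the `i`-th coordinate of a local embedding. -/
def Chart.coord (e : Chart X) (y : X) (hy : y ∈ e.source) (i : Fin e.dim) : Stalk y :=
  ⟨((fun x => e.toFun x i : X → ℂ) : Germ (𝓝 y) ℂ), (e.mem_stalk_iff y hy _).2
    ⟨fun a => a i, (ContinuousLinearMap.proj (R := ℂ) (φ := fun _ : Fin e.dim => ℂ) i).analyticAt _,
      rfl⟩⟩

/-- The differential of a local embedding, from the Zariski tangent space to `ℂⁿ`. -/
def Chart.differential (e : Chart X) (y : X) (hy : y ∈ e.source) (v : TangentSpaceAt y) :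
    Fin e.dim → ℂ :=
  fun i => v.1 (e.coord y hy i)

variable (X) in
/-- A (smooth) hermitian metric on a complex space: a sesquilinear form on every Zariski tangent
space such that, near every point, these forms are induced through a local embedding from a smooth
(positive definite) hermitian metric on the ambient open set of `ℂⁿ`. -/
structure HermitianMetric where
  form : ∀ x : X, TangentSpaceAt x →ₗ⋆[ℂ] TangentSpaceAt x →ₗ[ℂ] ℂ
  locally_ambient : ∀ x : X, ∃ e : Chart X, x ∈ e.source ∧
    ∃ H : (Fin e.dim → ℂ) → Matrix (Fin e.dim) (Fin e.dim) ℂ,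
      (∀ i j, ContDiffOn ℝ ∞ (fun a => H a i j) e.target) ∧
      (∀ a ∈ e.target, (H a).PosDef) ∧
      ∀ (y : X) (hy : y ∈ e.source) (v w : TangentSpaceAt y),
        form y v w =
          star (e.differential y hy v) ⬝ᵥ (H (e.toFun y) *ᵥ e.differential y hy w)

/-- The length of a tangent vector. -/
def HermitianMetric.norm (h : HermitianMetric X) {x : X} (v : TangentSpaceAt x) : ℝ :=
  √(h.form x v v).re

theorem HolDisc.tendsto (f : HolDisc X) {z : ℂ} (hz : z ∈ ball (0 : ℂ) 1) :
    Tendsto f (𝓝 z) (𝓝 (f z)) :=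
  f.continuousOn.continuousAt (isOpen_ball.mem_nhds hz)

/-- The derivative `f'(z)`, that is, the image of `∂/∂z` under the differential of `f` at `z`: the
derivation `g ↦ (g ∘ f)'(z)`. -/
def HolDisc.derivAt (f : HolDisc X) (z : ℂ) (hz : z ∈ ball (0 : ℂ) 1) : TangentSpaceAt (f z) :=
  ⟨fun g => (g.1.compTendsto f (f.tendsto hz)).liftOn (fun k => deriv k z)
      fun _ _ h => h.deriv_eq, by
    have hd : ∀ g : X → ℂ, (g : Germ (𝓝 (f z)) ℂ) ∈ Stalk (f z) →
        DifferentiableAt ℂ (g ∘ f) z := fun g hg => (f.holomorphic z hz g hg).differentiableAt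
    refine ⟨?_, ?_, ?_⟩
    · rintro ⟨a, ha⟩ ⟨b, hb⟩
      induction a using Germ.inductionOn with
      | _ a =>
      induction b using Germ.inductionOn with
      | _ b => exact deriv_add (hd a ha) (hd b hb)
    · rintro ⟨a, ha⟩ ⟨b, hb⟩
      induction a using Germ.inductionOn with
      | _ a =>
      induction b using Germ.inductionOn with
      | _ b =>
        refine (deriv_mul (hd a ha) (hd b hb)).trans ?_
        change deriv (a ∘ f) z * b (f z) + a (f z) * deriv (b ∘ f) z
          = a (f z) * deriv (b ∘ f) z + b (f z) * deriv (a ∘ f) z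
        ring
    · rintro ⟨a, ha⟩ c rfl
      exact deriv_const z c⟩

/-- The norm `‖f'(z)‖` of the differential of `f` at `z` with respect to the Poincaré metric
`|dz| / (1 - |z|²)` on the unit disc and the hermitian metric `h` on `X`. -/
def HermitianMetric.derivNorm (h : HermitianMetric X) (f : HolDisc X) (z : ℂ)
    (hz : z ∈ ball (0 : ℂ) 1) : ℝ :=
  h.norm (f.derivAt z hz) / (1 / (1 - ‖z‖ ^ 2))

end OrbifoldKobayashi

end

namespace OrbifoldKobayashi

universe v

variable {X : Type v} [TopologicalSpace X]

/-! ### A lower bound for a continuous family of positive definite matrices -/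

/-! The argument is by contraposition. If no sequence exists, then, `p` having a countable
neighbourhood basis, some neighbourhood of `p` and some constant bound `‖f'(0)‖` for every orbifold
disc centred in that neighbourhood. `kobayashiDist_ne_zero_of_derivNorm_le` shows that the
pseudodistance then separates `p` from every other point.

It does so by producing one explicit competitor in the supremum, `|u x - u y| / K`. Here `u` is the
distance to `p` in a chart, truncated at a small radius so that it is locally constant away from
that neighbourhood (`LocalEmbedding.exists_truncatedDist`). Orbifold discs are stable under
automorphisms of the disc, so the bound at the centre holds, for the Poincaré metric, wherever a
disc meets the neighbourhood. Elsewhere `u` does not vary, so integrating along radii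
(`HolDisc.abs_sub_le_mul_artanh`) makes `u / K` distance-decreasing on all orbifold discs, including
those that leave the chart. -/

theorem exists_mul_norm_sq_le_re {n : ℕ} {Ω : Set (Fin n → ℂ)} (hΩ : IsOpen Ω)
    {H : (Fin n → ℂ) → Matrix (Fin n) (Fin n) ℂ}
    (hH : ∀ i j, ContinuousOn (fun a => H a i j) Ω) (hpos : ∀ a ∈ Ω, (H a).PosDef)
    {a₀ : Fin n → ℂ} (ha₀ : a₀ ∈ Ω) :
    ∃ c : ℝ, 0 < c ∧ ∀ᶠ a in 𝓝 a₀, ∀ v : Fin n → ℂ,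
      c * ‖v‖ ^ 2 ≤ (star v ⬝ᵥ (H a *ᵥ v)).re := by
  obtain ⟨K, hK, hKΩ, hKc⟩ := local_compact_nhds (hΩ.mem_nhds ha₀)
  have hcont : ContinuousOn
      (fun x : (Fin n → ℂ) × (Fin n → ℂ) => (star x.2 ⬝ᵥ (H x.1 *ᵥ x.2)).re)
      (K ×ˢ sphere 0 1) := by
    refine Complex.continuous_re.comp_continuousOn ?_
    simp only [dotProduct, Matrix.mulVec, Pi.star_apply]
    refine continuousOn_finsetSum _ fun i _ => ContinuousOn.mul (by fun_prop) ?_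
    refine continuousOn_finsetSum _ fun j _ => ContinuousOn.mul ?_ (by fun_prop)
    exact (hH i j).comp continuousOn_fst fun x hx => hKΩ hx.1
  obtain ⟨c, hc, hmin⟩ : ∃ c : ℝ, 0 < c ∧ ∀ a ∈ K, ∀ v ∈ sphere (0 : Fin n → ℂ) 1,
      c ≤ (star v ⬝ᵥ (H a *ᵥ v)).re := by
    -- The sphere is empty when `n = 0`; any positive constant then works.
    rcases (K ×ˢ sphere (0 : Fin n → ℂ) 1).eq_empty_or_nonempty with he | hne
    · refine ⟨1, one_pos, fun a ha v hv => ?_⟩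
      have : (a, v) ∈ K ×ˢ sphere (0 : Fin n → ℂ) 1 := ⟨ha, hv⟩
      simp [he] at this
    · obtain ⟨⟨b, w⟩, ⟨hb, hw⟩, hbw⟩ :=
        (hKc.prod (isCompact_sphere 0 1)).exists_isMinOn hne hcont
      refine ⟨_, ?_, fun a ha v hv => hbw (show (a, v) ∈ _ from ⟨ha, hv⟩)⟩
      have hw0 : w ≠ 0 := by
        rintro rfl
        simp at hw
      exact (Complex.pos_iff.1 ((hpos b (hKΩ hb)).dotProduct_mulVec_pos hw0)).1
  refine ⟨c, hc, ?_⟩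
  filter_upwards [hK] with a ha v
  rcases eq_or_ne v 0 with rfl | hv
  · simp
  have hv' : ‖v‖ ≠ 0 := norm_ne_zero_iff.2 hv
  have h1 := hmin a ha (((‖v‖⁻¹ : ℝ) : ℂ) • v) (by simp [norm_smul, hv'])
  have h2 : (star (((‖v‖⁻¹ : ℝ) : ℂ) • v) ⬝ᵥ (H a *ᵥ (((‖v‖⁻¹ : ℝ) : ℂ) • v))).re
      = ‖v‖⁻¹ ^ 2 * (star v ⬝ᵥ (H a *ᵥ v)).re := by
    rw [star_smul, Matrix.mulVec_smul, smul_dotProduct, dotProduct_smul, smul_eq_mul, smul_eq_mul,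
      ← mul_assoc, ← Complex.re_ofReal_mul]
    congr 2
    simp [sq]
  rw [h2, inv_pow, inv_mul_eq_div, le_div_iff₀ (by positivity)] at h1
  exact h1

/-! ### The truncated distance to a point in a local embedding -/

theorem LocalEmbedding.continuousOn {O : ∀ x : X, Subring (Germ (𝓝 x) ℂ)}
    (e : LocalEmbedding O) : ContinuousOn e.toFun e.source :=
  continuousOn_iff_continuous_domRestrict.2 e.isEmbedding.continuous

/-- Truncation makes a function defined in a chart extend by a constant to all of `X`, so discs
leaving the chart need no control there. -/
theorem LocalEmbedding.exists_truncatedDist [T2Space X] [ParacompactSpace X]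
    {O : ∀ x : X, Subring (Germ (𝓝 x) ℂ)} (e : LocalEmbedding O)
    {p : X} (hp : p ∈ e.source) {U : Set X} (hU : U ∈ 𝓝 p) :
    ∃ (u : X → ℝ) (A : Set X), A ⊆ U ∩ e.source ∧
      (∀ y ∈ e.source, ∀ z ∈ e.source, |u y - u z| ≤ ‖e.toFun y - e.toFun z‖) ∧
      (∀ x ∉ A, ∀ᶠ y in 𝓝 x, u y = u x) ∧ ∀ q ≠ p, u p ≠ u q := by
  classical
  -- `W` must be closed in `X`, not only in the chart: it keeps the chart ball of radius `r` away
  -- from the boundary of `e.source`, where `u` could otherwise jump.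
  obtain ⟨W, hW, hWc, hWU⟩ :=
    exists_mem_nhds_isClosed_subset (inter_mem hU (e.isOpen_source.mem_nhds hp))
  obtain ⟨r, hr, hrW⟩ : ∃ r > 0, ∀ y ∈ e.source, ‖e.toFun y - e.toFun p‖ ≤ r → y ∈ W := by
    have h1 : (Subtype.val ⁻¹' W : Set e.source) ∈ 𝓝 (⟨p, hp⟩ : e.source) :=
      continuous_subtype_val.continuousAt.preimage_mem_nhds hW
    rw [e.isEmbedding.nhds_eq_comap] at h1
    obtain ⟨r, hr, hrs⟩ := (Metric.nhds_basis_closedBall.comap _).mem_iff.1 h1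
    refine ⟨r, hr, fun y hy hyr => @hrs ⟨y, hy⟩ ?_⟩
    simpa [dist_eq_norm] using hyr
  set u : X → ℝ := fun y => if y ∈ e.source then min ‖e.toFun y - e.toFun p‖ r else r with hu
  have hu1 : ∀ y ∈ e.source, u y = min ‖e.toFun y - e.toFun p‖ r := fun y hy => if_pos hy
  have hup : u p = 0 := by rw [hu1 p hp]; simp [hr.le]
  refine ⟨u, {y | y ∈ e.source ∧ ‖e.toFun y - e.toFun p‖ ≤ r}, fun y hy => hWU (hrW y hy.1 hy.2),
    fun y hy z hz => ?_, fun x hx => ?_, fun q hq => ?_⟩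
  · rw [hu1 y hy, hu1 z hz]
    refine (abs_min_sub_min_le_max _ _ _ _).trans ?_
    rw [sub_self, abs_zero, max_eq_left (abs_nonneg _)]
    exact (abs_norm_sub_norm_le _ _).trans_eq (by congr 1; abel)
  · have hfar : ∀ᶠ y in 𝓝 x, y ∈ e.source → r ≤ ‖e.toFun y - e.toFun p‖ := by
      by_cases hxs : x ∈ e.source
      · have hlt : r < ‖e.toFun x - e.toFun p‖ := not_le.1 fun h => hx ⟨hxs, h⟩
        have hc := e.continuousOn.continuousAt (e.isOpen_source.mem_nhds hxs)
        filter_upwards [((hc.sub continuousAt_const).norm).eventually (lt_mem_nhds hlt)] with y hy _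
        exact hy.le
      · have hxW : x ∉ W := fun h => hxs (hWU h).2
        filter_upwards [hWc.isOpen_compl.mem_nhds hxW] with y hy hys
        exact (not_le.1 fun h => hy (hrW y hys h)).le
    have hval : ∀ y, (y ∈ e.source → r ≤ ‖e.toFun y - e.toFun p‖) → u y = r := fun y hy => by
      by_cases hys : y ∈ e.source
      · rw [hu1 y hys, min_eq_right (hy hys)]
      · exact if_neg hys
    filter_upwards [hfar] with y hy
    rw [hval y hy, hval x hfar.self_of_nhds]
  · rw [hup]
    by_cases hqs : q ∈ e.source
    · rw [hu1 q hqs]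
      refine (lt_min (norm_pos_iff.2 (sub_ne_zero.2 fun h => hq ?_)) hr).ne
      exact congrArg Subtype.val (e.isEmbedding.injective (a₁ := ⟨q, hqs⟩) (a₂ := ⟨p, hp⟩) h)
    · rw [show u q = r from if_neg hqs]
      exact hr.ne

/-! ### Automorphisms of the disc -/

/-- The automorphism `w ↦ (w + a) / (1 + conj a * w)` of the unit disc. -/
noncomputable def discAut (a w : ℂ) : ℂ := (w + a) / (1 + conj a * w)

theorem one_add_conj_mul_ne_zero {a w : ℂ} (ha : ‖a‖ < 1) (hw : ‖w‖ < 1) :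
    1 + conj a * w ≠ 0 := by
  intro h
  have h1 : conj a * w = -1 := by linear_combination h
  have h2 : ‖a‖ * ‖w‖ = 1 := by
    rw [← Complex.norm_conj a, ← norm_mul, h1, norm_neg, norm_one]
  nlinarith [norm_nonneg a, norm_nonneg w]

/-- This rests on the identity `|1 + āw|² - |w + a|² = (1 - |a|²)(1 - |w|²)`. -/
theorem norm_discAut_lt_one {a w : ℂ} (ha : ‖a‖ < 1) (hw : ‖w‖ < 1) : ‖discAut a w‖ < 1 := by
  have h0 := one_add_conj_mul_ne_zero ha hw
  rw [discAut, norm_div, div_lt_one (norm_pos_iff.2 h0), ← sq_lt_sq₀ (by positivity) (by positivity),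
    ← Complex.normSq_eq_norm_sq, ← Complex.normSq_eq_norm_sq]
  have ha' : Complex.normSq a < 1 := by rw [Complex.normSq_eq_norm_sq]; nlinarith [norm_nonneg a]
  have hw' : Complex.normSq w < 1 := by rw [Complex.normSq_eq_norm_sq]; nlinarith [norm_nonneg w]
  have key : Complex.normSq (1 + conj a * w) - Complex.normSq (w + a)
      = (1 - Complex.normSq a) * (1 - Complex.normSq w) := by
    simp [Complex.normSq_apply]
    ring
  nlinarith [mul_pos (sub_pos.2 ha') (sub_pos.2 hw')]

theorem discAut_discAut_neg {a w : ℂ} (ha : ‖a‖ < 1) (hw : ‖w‖ < 1) :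
    discAut a (discAut (-a) w) = w := by
  have h0 := one_add_conj_mul_ne_zero (a := -a) (by simpa using ha) hw
  have h1 := one_add_conj_mul_ne_zero ha
    (norm_discAut_lt_one (a := -a) (by simpa using ha) hw)
  have h2 : discAut (-a) w * (1 + conj (-a) * w) = w + -a := div_mul_cancel₀ _ h0
  rw [discAut, div_eq_iff h1]
  rw [map_neg] at h2
  linear_combination h2

theorem hasDerivAt_discAut {a w : ℂ} (ha : ‖a‖ < 1) (hw : ‖w‖ < 1) :
    HasDerivAt (discAut a) ((1 - ‖a‖ ^ 2) / (1 + conj a * w) ^ 2) w := by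
  have h := ((hasDerivAt_id w).add_const a).div
    (((hasDerivAt_id w).const_mul (conj a)).const_add 1) (one_add_conj_mul_ne_zero ha hw)
  refine h.congr_deriv ?_
  have : ((‖a‖ : ℂ)) ^ 2 = conj a * a := by rw [mul_comm, Complex.mul_conj']
  rw [this]
  simp
  ring

theorem analyticAt_discAut {a w : ℂ} (ha : ‖a‖ < 1) (hw : ‖w‖ < 1) :
    AnalyticAt ℂ (discAut a) w :=
  (analyticAt_id.add analyticAt_const).div
    (analyticAt_const.add (analyticAt_const.mul analyticAt_id)) (one_add_conj_mul_ne_zero ha hw)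

theorem deriv_discAut_ne_zero {a w : ℂ} (ha : ‖a‖ < 1) (hw : ‖w‖ < 1) :
    deriv (discAut a) w ≠ 0 := by
  rw [(hasDerivAt_discAut ha hw).deriv]
  refine div_ne_zero ?_ (pow_ne_zero 2 (one_add_conj_mul_ne_zero ha hw))
  have : (1 - ‖a‖ ^ 2 : ℝ) ≠ 0 := by nlinarith [norm_nonneg a]
  exact_mod_cast this

@[simp]
theorem discAut_zero (a : ℂ) : discAut a 0 = a := by simp [discAut]

variable [ReducedComplexSpace X]

/-- The composition of a holomorphic disc with an automorphism of the unit disc. -/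
noncomputable def HolDisc.compAut (f : HolDisc X) (a : ℂ) (ha : ‖a‖ < 1) : HolDisc X where
  toFun w := f (discAut a w)
  continuousOn := fun w hw => by
    have hw' := mem_ball_zero_iff.1 hw
    exact ((f.tendsto (mem_ball_zero_iff.2 (norm_discAut_lt_one ha hw'))).comp
      (analyticAt_discAut ha hw').continuousAt).mono_left nhdsWithin_le_nhds
  holomorphic := fun w hw g hg => by
    have hw' := mem_ball_zero_iff.1 hw
    exact (f.holomorphic _ (mem_ball_zero_iff.2 (norm_discAut_lt_one ha hw')) g hg).comp
      (analyticAt_discAut ha hw')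

/-- The composition of an orbifold morphism with an automorphism of the unit disc. -/
noncomputable def OrbifoldDisc.compAut {Δ : OrbifoldDivisor X} (f : OrbifoldDisc Δ) (a : ℂ) (ha : ‖a‖ < 1) :
    OrbifoldDisc Δ where
  toHolDisc := f.toHolDisc.compAut a ha
  not_subset_support := by
    obtain ⟨z, hz, hzΔ⟩ := f.not_subset_support
    have hz' := mem_ball_zero_iff.1 hz
    refine ⟨discAut (-a) z, mem_ball_zero_iff.2 (norm_discAut_lt_one (by simpa using ha) hz'), ?_⟩
    change f.toFun (discAut a (discAut (-a) z)) ∉ _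
    rwa [discAut_discAut_neg ha hz']
  mult_le := fun Z z hz hfz => by
    have hz' := mem_ball_zero_iff.1 hz
    refine (f.mult_le Z _ (mem_ball_zero_iff.2 (norm_discAut_lt_one ha hz')) hfz).trans
      (le_iInf₂ fun g hg => ?_)
    refine (iInf₂_le g hg).trans_eq ?_
    -- An automorphism is locally biholomorphic, so it preserves vanishing orders and hence the
    -- multiplicity conditions.
    exact (analyticOrderAt_comp_of_deriv_ne_zero (f := fun w => g (f w))
      (analyticAt_discAut ha hz') (deriv_discAut_ne_zero ha hz')).symm
  notMem_of_mult_eq_top := fun Z hZ z hz =>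
    f.notMem_of_mult_eq_top Z hZ _
      (mem_ball_zero_iff.2 (norm_discAut_lt_one ha (mem_ball_zero_iff.1 hz)))

/-! ### Discs in a local embedding -/

theorem HolDisc.differentiableAt_comp_toFun (f : HolDisc X) (e : Chart X) {z : ℂ}
    (hz : z ∈ ball (0 : ℂ) 1) (hfz : f z ∈ e.source) :
    DifferentiableAt ℂ (fun w => e.toFun (f w)) z :=
  differentiableAt_pi.2 fun i =>
    (f.holomorphic z hz _ (e.coord (f z) hfz i).2).differentiableAt

theorem HolDisc.differential_derivAt (f : HolDisc X) (e : Chart X) {z : ℂ}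
    (hz : z ∈ ball (0 : ℂ) 1) (hfz : f z ∈ e.source) :
    e.differential (f z) hfz (f.derivAt z hz) = deriv (fun w => e.toFun (f w)) z := by
  rw [deriv_pi fun i => differentiableAt_pi.1 (f.differentiableAt_comp_toFun e hz hfz) i]
  rfl

/-- A bound for the derivative at the centre of discs starting in `U` gives a bound for the
derivative, with respect to the Poincaré metric, at all points mapped to `U`. -/
theorem norm_deriv_mul_le_of_forall_zero {Δ : OrbifoldDivisor X} {e : Chart X} {U : Set X}
    (hU : U ⊆ e.source) {C : ℝ}
    (hC : ∀ f : OrbifoldDisc Δ, f 0 ∈ U → ‖deriv (fun w => e.toFun (f w)) 0‖ ≤ C)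
    (f : OrbifoldDisc Δ) {z : ℂ} (hz : z ∈ ball (0 : ℂ) 1) (hfz : f z ∈ U) :
    ‖deriv (fun w => e.toFun (f w)) z‖ * (1 - ‖z‖ ^ 2) ≤ C := by
  have hz' := mem_ball_zero_iff.1 hz
  have h0 : (f.compAut z hz') 0 = f z := congrArg f.toFun (discAut_zero z)
  have h1 := hC (f.compAut z hz') (h0 ▸ hfz)
  have h2 : HasDerivAt (fun w => e.toFun (f w)) (deriv (fun w => e.toFun (f w)) z)
      (discAut z 0) := by
    rw [discAut_zero]
    exact (f.differentiableAt_comp_toFun e hz (hU hfz)).hasDerivAt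
  -- The automorphism sending `0` to `z` has derivative `1 - ‖z‖²` at `0`, exactly the Poincaré
  -- factor.
  have h3 := (h2.scomp (0 : ℂ) (hasDerivAt_discAut hz' (by simp))).deriv
  have h4 : (fun w => e.toFun (f w)) ∘ discAut z = fun w => e.toFun ((f.compAut z hz') w) := rfl
  rw [h4] at h3
  rw [h3, norm_smul] at h1
  have h5 : ‖(1 - (‖z‖ : ℂ) ^ 2) / (1 + conj z * 0) ^ 2‖ = 1 - ‖z‖ ^ 2 := by
    have : (1 - (‖z‖ : ℂ) ^ 2) / (1 + conj z * 0) ^ 2 = ((1 - ‖z‖ ^ 2 : ℝ) : ℂ) := by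
      simp
    rw [this, Complex.norm_real, Real.norm_of_nonneg]
    nlinarith [norm_nonneg z]
  rwa [h5, mul_comm] at h1

/-- The hermitian metric dominates, near a point, the norm of a local embedding. -/
theorem HermitianMetric.exists_chart_norm_differential_le (h : HermitianMetric X) (x : X) :
    ∃ e : Chart X, x ∈ e.source ∧ ∃ C : ℝ, 0 < C ∧ ∃ U ∈ 𝓝 x, U ⊆ e.source ∧
      ∀ (y : X) (hy : y ∈ e.source), y ∈ U → ∀ v : TangentSpaceAt y,
        ‖e.differential y hy v‖ ≤ C * h.norm v := by
  obtain ⟨e, hx, H, hH, hpos, hform⟩ := h.locally_ambient x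
  obtain ⟨c, hc, hev⟩ := exists_mul_norm_sq_le_re e.isOpen_target
    (fun i j => (hH i j).continuousOn) hpos (e.isAnalytic_image.1 (mem_image_of_mem _ hx))
  have hcont := e.continuousOn.continuousAt (e.isOpen_source.mem_nhds hx)
  refine ⟨e, hx, (√c)⁻¹, by positivity, _,
    inter_mem (e.isOpen_source.mem_nhds hx) (hcont.eventually hev), inter_subset_left,
    fun y hy hyU v => ?_⟩
  have h1 := hyU.2 (e.differential y hy v)
  rw [← hform y hy v v] at h1
  have h2 := Real.sqrt_le_sqrt h1
  rw [Real.sqrt_mul hc.le, Real.sqrt_sq (norm_nonneg _)] at h2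
  rw [inv_mul_eq_div, le_div_iff₀ (by positivity), mul_comm]
  exact h2

/-! ### Comparison with the Poincaré distance -/

/-- The Poincaré density `1 / (1 - t²)` integrates to `artanh` along a radius. -/
theorem hasDerivAt_half_log_sub_log {t : ℝ} (h0 : 0 ≤ t) (h1 : t < 1) :
    HasDerivAt (fun s => (Real.log (1 + s) - Real.log (1 - s)) / 2) (1 / (1 - t ^ 2)) t := by
  have hp : 1 + t ≠ 0 := by positivity
  have hm : 1 - t ≠ 0 := (sub_pos.2 h1).ne'
  have h := ((((hasDerivAt_id t).const_add 1).log hp).sub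
    (((hasDerivAt_id t).const_sub 1).log hm)).div_const 2
  refine h.congr_deriv ?_
  have : 1 - t ^ 2 ≠ 0 := by
    rw [show 1 - t ^ 2 = (1 + t) * (1 - t) by ring]
    exact mul_ne_zero hp hm
  simp only [id]
  field_simp
  ring

theorem artanh_eq_half_log_sub_log {t : ℝ} (h0 : 0 ≤ t) (h1 : t < 1) :
    Real.artanh t = (Real.log (1 + t) - Real.log (1 - t)) / 2 := by
  rw [Real.artanh_eq_half_log ⟨by linarith, h1.le⟩,
    Real.log_div (by positivity) (sub_pos.2 h1).ne']
  ring

/-- Let `u` be a function that is Lipschitz in a local embedding and locally constant outside `A`.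
Along a disc whose derivative is bounded at the points mapped to `A`, the function `u` grows at most
like the Poincaré distance to the centre. -/
theorem HolDisc.abs_sub_le_mul_artanh (f : HolDisc X) {e : Chart X} {u : X → ℝ} {A : Set X}
    (hA : A ⊆ e.source)
    (hlip : ∀ y ∈ e.source, ∀ z ∈ e.source, |u y - u z| ≤ ‖e.toFun y - e.toFun z‖)
    (hconst : ∀ x ∉ A, ∀ᶠ y in 𝓝 x, u y = u x) {C K : ℝ} (hC : 0 ≤ C) (hCK : C < K)
    (hbound : ∀ z ∈ ball (0 : ℂ) 1, f z ∈ A →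
      ‖deriv (fun w => e.toFun (f w)) z‖ * (1 - ‖z‖ ^ 2) ≤ C)
    {ζ : ℂ} (hζ : ‖ζ‖ < 1) : |u (f ζ) - u (f 0)| ≤ K * Real.artanh ‖ζ‖ := by
  rcases eq_or_ne ζ 0 with rfl | hζ0
  · simp
  have hucont : Continuous u := by
    refine continuous_iff_continuousAt.2 fun x => ?_
    by_cases hx : x ∈ A
    · have hs := e.isOpen_source.mem_nhds (hA hx)
      have hc := e.continuousOn.continuousAt hs
      refine tendsto_iff_norm_sub_tendsto_zero.2 (squeeze_zero' (Eventually.of_forall fun _ =>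
        norm_nonneg _) ?_ (tendsto_iff_norm_sub_tendsto_zero.1 hc))
      filter_upwards [hs] with y hy
      exact hlip y hy x (hA hx)
    · exact (tendsto_const_nhds (x := u x)).congr' ((hconst x hx).mono fun _ h => h.symm)
  set ξ : ℂ := ζ / ‖ζ‖ with hξ
  have hξ1 : ‖ξ‖ = 1 := by simp [hξ, hζ0]
  have hnorm : ∀ t : ℝ, ‖(t : ℂ) * ξ‖ = |t| := fun t => by simp [hξ1]
  have hmem : ∀ t : ℝ, 0 ≤ t → t < 1 → (t : ℂ) * ξ ∈ ball (0 : ℂ) 1 := fun t h0 h1 => by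
    rw [mem_ball_zero_iff, hnorm, abs_of_nonneg h0]; exact h1
  have hγ : ∀ t : ℝ, 0 ≤ t → t < 1 → ContinuousAt (fun s : ℝ => f ((s : ℂ) * ξ)) t :=
    fun t h0 h1 => (f.tendsto (hmem t h0 h1)).comp
      (show ContinuousAt (fun s : ℝ => (s : ℂ) * ξ) t by fun_prop)
  set F : ℝ → ℝ := fun t => |u (f ((t : ℂ) * ξ)) - u (f 0)| with hF
  -- `F` need not be differentiable, so a comparison principle for right slopes replaces
  -- integration. It requires a strict inequality of slopes where `F` meets the barrier, whence `C <
  -- K`.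
  have main := image_le_of_liminf_slope_right_lt_deriv_boundary' (f := F)
    (f' := fun t => C / (1 - t ^ 2)) (a := 0) (b := ‖ζ‖)
    (B := fun t => K * ((Real.log (1 + t) - Real.log (1 - t)) / 2))
    (B' := fun t => K * (1 / (1 - t ^ 2))) ?_ ?_ ?_ ?_ ?_ ?_ (right_mem_Icc.2 (norm_nonneg ζ))
  · have h1 : ((‖ζ‖ : ℝ) : ℂ) * ξ = ζ := by
      rw [hξ, mul_div_cancel₀]
      simpa using hζ0
    rw [artanh_eq_half_log_sub_log (norm_nonneg _) hζ]
    simpa only [hF, h1] using main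
  · intro t ht
    exact (((hucont.continuousAt.comp (hγ t ht.1 (ht.2.trans_lt hζ))).sub
      continuousAt_const).abs).continuousWithinAt
  · intro t ht r hr
    have ht1 : t < 1 := ht.2.trans hζ
    have hpos : 0 < 1 - t ^ 2 := by nlinarith [ht.1]
    refine Eventually.frequently ?_
    have hslope : ∀ s > t, slope F t s
        ≤ ‖u (f ((s : ℂ) * ξ)) - u (f ((t : ℂ) * ξ))‖ / (s - t) := fun s hs => by
      rw [slope_def_field]
      refine div_le_div_of_nonneg_right ?_ (sub_pos.2 hs).le
      refine (abs_sub_abs_le_abs_sub _ _).trans_eq ?_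
      rw [sub_sub_sub_cancel_right, Real.norm_eq_abs]
    have hr0 : 0 < r := lt_of_le_of_lt (by positivity) hr
    -- On `A` the slope is controlled by the derivative in the chart; off `A` it vanishes near `t`.
    by_cases hA' : f ((t : ℂ) * ξ) ∈ A
    · have hd := (f.differentiableAt_comp_toFun e (hmem t ht.1 ht1) (hA hA')).hasDerivAt
      have hlin : HasDerivAt (fun s : ℝ => (s : ℂ) * ξ) (1 * ξ) t :=
        (Complex.ofRealCLM.hasDerivAt (x := t)).mul_const ξ
      have hd2 := HasDerivAt.scomp (h := fun s : ℝ => (s : ℂ) * ξ) t hd hlin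
      have hle : ‖(1 * ξ) • deriv (fun w => e.toFun (f w)) ((t : ℂ) * ξ)‖ < r := by
        rw [one_mul, norm_smul, hξ1, one_mul]
        refine lt_of_le_of_lt ?_ hr
        rw [le_div_iff₀ hpos]
        simpa only [hnorm, sq_abs] using hbound _ (hmem t ht.1 ht1) hA'
      filter_upwards [hd2.hasDerivWithinAt.limsup_norm_slope_le (s := Ioi t) hle,
        (hγ t ht.1 ht1).continuousWithinAt (e.isOpen_source.mem_nhds (hA hA')),
        self_mem_nhdsWithin] with s hs1 hs2 hs3
      refine ((hslope s hs3).trans ?_).trans_lt hs1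
      rw [Real.norm_of_nonneg (sub_pos.2 hs3).le, inv_mul_eq_div]
      exact div_le_div_of_nonneg_right (hlip _ hs2 _ (hA hA')) (sub_pos.2 hs3).le
    · filter_upwards [(hγ t ht.1 ht1).continuousWithinAt (hconst _ hA'), self_mem_nhdsWithin]
        with s hs1 hs2
      refine (hslope s hs2).trans_lt ?_
      have hs1' : u (f ((s : ℂ) * ξ)) = u (f ((t : ℂ) * ξ)) := hs1
      rw [hs1', sub_self, norm_zero, zero_div]
      exact hr0
  · simp [hF]
  · intro t ht
    exact ((hasDerivAt_half_log_sub_log ht.1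
      (ht.2.trans_lt hζ)).continuousAt.const_mul K).continuousWithinAt
  · intro t ht
    exact ((hasDerivAt_half_log_sub_log ht.1 (ht.2.trans hζ)).const_mul K).hasDerivWithinAt
  · intro t ht _
    have hpos : 0 < 1 - t ^ 2 := by nlinarith [ht.1, ht.2.trans hζ]
    change C / (1 - t ^ 2) < K * (1 / (1 - t ^ 2))
    rw [mul_one_div]
    exact div_lt_div_of_pos_right hCK hpos

/-- Precomposing with the automorphism sending `0` to `w` reduces the estimate to one from the
centre. -/
theorem OrbifoldDisc.abs_sub_le_mul_poincareDist {Δ : OrbifoldDivisor X} {u : X → ℝ} {K : ℝ}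
    (hu : ∀ f : OrbifoldDisc Δ, ∀ ζ : ℂ, ‖ζ‖ < 1 → |u (f ζ) - u (f 0)| ≤ K * Real.artanh ‖ζ‖)
    (f : OrbifoldDisc Δ) {z w : ℂ} (hz : ‖z‖ < 1) (hw : ‖w‖ < 1) :
    |u (f z) - u (f w)| ≤ K * poincareDist z w := by
  have h1 := hu (f.compAut w hw) (discAut (-w) z) (norm_discAut_lt_one (by simpa using hw) hz)
  have h2 : (f.compAut w hw) (discAut (-w) z) = f z :=
    congrArg f.toFun (discAut_discAut_neg hw hz)
  have h3 : (f.compAut w hw) 0 = f w := congrArg f.toFun (discAut_zero w)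
  have h4 : ‖discAut (-w) z‖ = ‖z - w‖ / ‖1 - conj w * z‖ := by
    simp [discAut, sub_eq_add_neg]
  rwa [h2, h3, h4] at h1

theorem mem_admissiblePseudodistances_of_abs_sub_le {Δ : OrbifoldDivisor X} {u : X → ℝ} {K : ℝ}
    (hK : 0 < K)
    (hu : ∀ (f : OrbifoldDisc Δ) (z w : ℂ), ‖z‖ < 1 → ‖w‖ < 1 →
      |u (f z) - u (f w)| ≤ K * poincareDist z w) :
    (fun x y : ↥(Δ.supportOneᶜ) => |u x - u y| / K) ∈ admissiblePseudodistances Δ := by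
  refine ⟨⟨fun x y => by positivity, fun x => by simp, fun x y => by rw [abs_sub_comm],
    fun x y z => ?_⟩, fun f z hz w hw x y hx hy => ?_⟩
  · rw [← add_div]
    exact div_le_div_of_nonneg_right (abs_sub_le _ _ _) hK.le
  · rw [div_le_iff₀' hK, ← hx, ← hy]
    exact hu f z w (mem_ball_zero_iff.1 hz) (mem_ball_zero_iff.1 hw)

/-- If the derivatives at the centre of the orbifold morphisms starting near `p` are bounded, then
the orbifold Kobayashi pseudodistance separates `p` from all other points. -/
theorem kobayashiDist_ne_zero_of_derivNorm_le [T2Space X] [ParacompactSpace X]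
    {Δ : OrbifoldDivisor X} (h : HermitianMetric X) {p q : ↥(Δ.supportOneᶜ)} (hpq : p ≠ q)
    {U : Set X} (hU : U ∈ 𝓝 (p : X)) {N : ℝ}
    (hN : ∀ f : OrbifoldDisc Δ, f 0 ∈ U →
      h.derivNorm f.toHolDisc 0 (mem_ball_self one_pos) ≤ N) :
    kobayashiDist Δ p q ≠ 0 := by
  obtain ⟨e, hp, C, hC, V, hV, hVs, hle⟩ := h.exists_chart_norm_differential_le (p : X)
  obtain ⟨u, A, hA, hlip, hconst, hsep⟩ := e.exists_truncatedDist hp (inter_mem hU hV)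
  -- `N` may be negative, whereas the radial estimate needs a nonnegative bound.
  set M : ℝ := C * |N| with hM
  have hbound : ∀ f : OrbifoldDisc Δ, f 0 ∈ U ∩ V →
      ‖deriv (fun w => e.toFun (f w)) 0‖ ≤ M := fun f hf => by
    rw [← f.differential_derivAt e (mem_ball_self one_pos) (hVs hf.2)]
    refine (hle _ (hVs hf.2) hf.2 _).trans (mul_le_mul_of_nonneg_left ?_ hC.le)
    have h1 := hN f hf.1
    simp only [HermitianMetric.derivNorm, norm_zero] at h1
    norm_num at h1
    exact h1.trans (le_abs_self N)
  have hK : 0 < M + 1 := by positivity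
  have hadm := mem_admissiblePseudodistances_of_abs_sub_le (Δ := Δ) (u := u) hK
    fun f z w hz hw => f.abs_sub_le_mul_poincareDist (fun g ζ hζ =>
      g.abs_sub_le_mul_artanh (hA.trans inter_subset_right) hlip hconst (C := M) (by positivity)
        (lt_add_one M) (fun a ha hga => norm_deriv_mul_le_of_forall_zero
          (inter_subset_right.trans hVs) hbound g ha (hA hga).1) hζ) hz hw
  -- The supremum is at least its value on this one pseudodistance, which is positive because `u`
  -- separates `p` from `q`.
  refine ((ENNReal.ofReal_pos.2 ?_).trans_le (le_iSup₂_of_le _ hadm le_rfl)).ne'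
  have : u p - u q ≠ 0 := sub_ne_zero.2 (hsep q fun h => hpq (Subtype.ext h.symm))
  positivity

/-! ### Extraction of the sequence -/

theorem OrbifoldDisc.apply_notMem_supportOne {Δ : OrbifoldDivisor X} (f : OrbifoldDisc Δ) {z : ℂ}
    (hz : z ∈ ball (0 : ℂ) 1) : f z ∈ Δ.supportOneᶜ := by
  simp only [OrbifoldDivisor.supportOne, mem_compl_iff, mem_iUnion, not_exists]
  exact fun Z hZ => f.notMem_of_mult_eq_top Z hZ z hz

/-- The local models lie in `ℂⁿ`, so `X` is first countable, and sequences suffice to approach `p`.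
-/
theorem nhds_isCountablyGenerated (x : X) : (𝓝 x).IsCountablyGenerated := by
  obtain ⟨e, hx⟩ := ReducedComplexSpace.exists_localEmbedding x
  have h1 : 𝓝 x = map Subtype.val (𝓝 (⟨x, hx⟩ : e.source)) :=
    (e.isOpen_source.isOpenEmbedding_subtypeVal.map_nhds_eq ⟨x, hx⟩).symm
  rw [h1, e.isEmbedding.nhds_eq_comap]
  infer_instance

end OrbifoldKobayashi

open OrbifoldKobayashi in
theorem proposition12 {X : Type*} [TopologicalSpace X] [T2Space X] [ParacompactSpace X]
    [OrbifoldKobayashi.ReducedComplexSpace X]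
    (hnormal : OrbifoldKobayashi.IsNormalSpace X)
    (hirr : OrbifoldKobayashi.IsIrreducibleAnalytic (Set.univ : Set X))
    (Δ : OrbifoldKobayashi.OrbifoldDivisor X)
    (p q : ↥(Δ.supportOneᶜ)) (hpq : p ≠ q)
    (hdist : OrbifoldKobayashi.kobayashiDist Δ p q = 0)
    (h : OrbifoldKobayashi.HermitianMetric X) :
    ∃ (P : ℕ → ↥(Δ.supportOneᶜ)) (f : ℕ → OrbifoldKobayashi.OrbifoldDisc Δ),
      (∀ n, f n 0 = P n) ∧
      Tendsto P atTop (𝓝 p) ∧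
      Tendsto (fun n => h.derivNorm (f n).toHolDisc 0 (mem_ball_self one_pos)) atTop atTop := by
  have := nhds_isCountablyGenerated (p : X)
  obtain ⟨U, hU⟩ := (𝓝 (p : X)).exists_antitone_basis
  have hex : ∀ n : ℕ, ∃ f : OrbifoldDisc Δ, f 0 ∈ U n ∧
      (n : ℝ) < h.derivNorm f.toHolDisc 0 (mem_ball_self one_pos) := fun n => by
    by_contra! hcon
    exact kobayashiDist_ne_zero_of_derivNorm_le h hpq (hU.mem n) hcon hdist
  choose f hfU hfn using hex
  refine ⟨fun n => ⟨f n 0, (f n).apply_notMem_supportOne (mem_ball_self one_pos)⟩, f,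
    fun n => rfl, tendsto_subtype_rng.2 (hU.tendsto hfU), ?_⟩
  exact tendsto_atTop_mono (fun n => (hfn n).le) tendsto_natCast_atTop_atTop
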